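/- Let $(\Omega,\mathcal F,P)$ be a complete probability space with a filtration $\mathbb F=(\mathcal F_t)_{t\ge 0}$ satisfying the usual conditions (it is right-continuous and $\mathcal F_0$ contains all $P$-null sets of $\mathcal F$), and put $\mathcal F_\infty:=\bigvee_{t\ge0}\mathcal F_t$. Let $\tau$ be a random time, i.e. a random variable with values in $(0,+\infty]$, and let $A=(A_t)_{t\ge0}$ be its Azéma supermartingale, i.e. the càdlàg version of the $\mathbb F$-optional projection of $1_{[0,\tau)}$: $A$ is $\mathbb F$-optional, its paths are a.s. càdlàg, and $A_\eta 1_{\{\eta<\infty\}}=E[1_{\{\eta<\tau\}}1_{\{\eta<\infty\}}\mid\mathcal F_\eta]$ a.s. for every $\mathbb F$-stopping time $\eta$. Let $A_-$ be the left-limit process of $A$, with the conventions $A_{0-}:=A_0$ and $A_{\infty-}:=A_\infty:=P[\tau=+\infty\mid\mathcal F_\infty]$. Then (i) $A>0$ a.s. on $[0,\tau)$: for almost every $\omega$, $A_t(\omega)>0$ for all $0\le t<\tau(\omega)$. (ii) $A_->0$ a.s. on $[0,\tau]$: for almost every $\omega$, $A_{t-}(\omega)>0$ for all $t\in[0,+\infty]$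 with $t\le\tau(\omega)$. Moreover $A_{\infty-}$ is indeed the limit of $A$ at infinity: $A_t\to A_\infty$ a.s. as $t\to+\infty$. -/

import Mathlib

open MeasureTheory Filter Topology
open scoped NNReal ENNReal

namespace Azema

/-- The usual conditions: right-continuity, and `𝓕 0` contains all null sets of the
ambient σ-algebra. -/
structure UsualConditions {Ω : Type*} {m : MeasurableSpace Ω} (μ : Measure Ω)
    (𝓕 : Filtration ℝ≥0 m) : Prop where
  rightContinuous : 𝓕.IsRightContinuous
  null_mem : ∀ s : Set Ω, MeasurableSet s → μ s = 0 → MeasurableSet[𝓕 0] s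

/-- A path on `[0, ∞)` which is right-continuous and has a finite left limit at every point
(the second condition is void at `t = 0`). -/
def IsCadlag (f : ℝ≥0 → ℝ) : Prop :=
  ∀ t : ℝ≥0, ContinuousWithinAt f (Set.Ici t) t ∧ ∃ l : ℝ, Tendsto f (𝓝[<] t) (𝓝 l)

/-- The optional σ-algebra on `[0, ∞) × Ω`, generated by the adapted càdlàg processes. -/
@[reducible]
def optional {Ω : Type*} {m : MeasurableSpace Ω} (𝓕 : Filtration ℝ≥0 m) :
    MeasurableSpace (ℝ≥0 × Ω) :=
  MeasurableSpace.generateFrom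
    {S | ∃ X : ℝ≥0 → Ω → ℝ, Adapted 𝓕 X ∧ (∀ ω, IsCadlag fun t => X t ω) ∧
      ∃ B : Set ℝ, MeasurableSet B ∧ S = Function.uncurry X ⁻¹' B}

/-- The random variable `X_η 1_{η < ∞}`. -/
noncomputable def valueAt {Ω : Type*} (X : ℝ≥0 → Ω → ℝ) (η : Ω → WithTop ℝ≥0) : Ω → ℝ :=
  {ω | η ω < ⊤}.indicator (stoppedValue X η)

/-- `Y` is (a version of) the optional projection of the bounded measurable process `X`:
it is optional and `Y_η 1_{η < ∞} = E[X_η 1_{η < ∞} | 𝓕_η]` a.s. for every stopping time `η`. -/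
structure IsOptionalProjection {Ω : Type*} {m : MeasurableSpace Ω} (μ : Measure Ω)
    (𝓕 : Filtration ℝ≥0 m) (X Y : ℝ≥0 → Ω → ℝ) : Prop where
  optional : Measurable[Azema.optional 𝓕] (Function.uncurry Y)
  projection : ∀ (η : Ω → WithTop ℝ≥0) (hη : IsStoppingTime 𝓕 η),
    valueAt Y η =ᵐ[μ] μ[valueAt X η | hη.measurableSpace]

/-- A random time: a random variable with values in `(0, ∞]`. -/
structure IsRandomTime {Ω : Type*} [MeasurableSpace Ω] (τ : Ω → ℝ≥0∞) : Prop where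
  measurable : Measurable τ
  pos : ∀ ω, 0 < τ ω

/-- The process `1_{[0, τ)} = 1 - H`. -/
noncomputable def survival {Ω : Type*} (τ : Ω → ℝ≥0∞) (t : ℝ≥0) : Ω → ℝ :=
  {ω | (t : ℝ≥0∞) < τ ω}.indicator fun _ => 1

/-- `A` is the Azéma supermartingale of `τ`: the càdlàg version of the optional projection of
`1_{[0, τ)}`. The paths only have to be càdlàg almost surely, so that every process
indistinguishable from such a version (and optional) is admitted. -/
structure IsAzemaSupermartingale {Ω : Type*} {m : MeasurableSpace Ω} (μ : Measure Ω)
    (𝓕 : Filtration ℝ≥0 m) (τ : Ω → ℝ≥0∞) (A : ℝ≥0 → Ω → ℝ) : Prop where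
  isOptionalProjection : IsOptionalProjection μ 𝓕 (survival τ) A
  cadlag : ∀ᵐ ω ∂μ, IsCadlag fun t => A t ω

/-- `A_∞ = P[τ = ∞ | 𝓕_∞]`, where `𝓕_∞` is generated by all the `𝓕 t`. -/
noncomputable def terminal {Ω : Type*} {m : MeasurableSpace Ω} (μ : Measure Ω)
    (𝓕 : Filtration ℝ≥0 m) (τ : Ω → ℝ≥0∞) : Ω → ℝ :=
  μ[{ω | τ ω = ∞}.indicator (fun _ => (1 : ℝ)) | ⨆ t, 𝓕 t]

open scoped Classical in
/-- The left-limit process `X_-` on `[0, ∞]`, with `X_{∞-}` equal to the given terminal variable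
`Xinf`. By the convention in `Function.leftLim`, `X_{0-} = X_0`. -/
noncomputable def leftLimit {Ω : Type*} (X : ℝ≥0 → Ω → ℝ) (Xinf : Ω → ℝ)
    (t : ℝ≥0∞) (ω : Ω) : ℝ :=
  if t = ∞ then Xinf ω else Function.leftLim (fun s => X s ω) t.toNNReal

end Azema

/-! Both positivity claims follow from one stronger fact (`ae_exists_pos_le_azema`): almost surely a
random constant `c > 0` bounds `A` from below on `[0, τ)`. At the first of finitely many times where
the projection is below `c`, the conditional probability of still being before `τ` is less than `c`;
hence `{A < c at some time before τ}` has probability at most `c`. Let `c → 0`, using a dense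
sequence of times and right-continuity. The bound passes to left limits and, when `τ = ∞`, to the
limit at infinity. That limit is identified in `tendsto_azema_terminal`: for `t ≥ n`, `|A_t - P[τ =
∞ | 𝓕 n]|` is dominated by a martingale closed by a variable that tends to `0` in `L¹` as `n → ∞`. A
maximal inequality and Lévy's upward theorem conclude. -/

namespace Azema

/-! ### First-entry decomposition and a maximal inequality. -/

section FirstEntry

variable {Ω ι : Type*} [LinearOrder ι]

/-- The part of `B t` not covered by the sets `B s` with `s ∈ D`, `s < t`. -/
def firstEntry (D : Finset ι) (B : ι → Set Ω) (t : ι) : Set Ω :=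
  B t \ ⋃ s ∈ D.filter (· < t), B s

/-- The bound `s ≤ t` matters later: if `t` lies before `τ`, so does the first entry `s`. -/
lemma exists_mem_firstEntry {D : Finset ι} {B : ι → Set Ω} {t : ι} (ht : t ∈ D) {ω : Ω}
    (hω : ω ∈ B t) : ∃ s ∈ D, s ≤ t ∧ ω ∈ firstEntry D B s := by
  classical
  have hne : (D.filter fun s => ω ∈ B s).Nonempty := ⟨t, by simp [ht, hω]⟩
  obtain ⟨h1, h2⟩ := Finset.mem_filter.1 (Finset.min'_mem _ hne)
  refine ⟨_, h1, Finset.min'_le _ _ (by simp [ht, hω]), h2, ?_⟩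
  simp only [Set.mem_iUnion, not_exists]
  intro s hs hsω
  obtain ⟨hsD, hlt⟩ := Finset.mem_filter.1 hs
  exact absurd (Finset.min'_le _ s (by simp [hsD, hsω])) (not_le.2 hlt)

lemma pairwiseDisjoint_firstEntry (D : Finset ι) (B : ι → Set Ω) :
    (D : Set ι).PairwiseDisjoint (firstEntry D B) := by
  have key : ∀ s ∈ D, ∀ t ∈ D, s < t → Disjoint (firstEntry D B s) (firstEntry D B t) := by
    intro s hs t _ hst
    refine Set.disjoint_left.2 fun ω h1 h2 => h2.2 ?_
    simp only [Set.mem_iUnion]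
    exact ⟨s, by simpa using ⟨hs, hst⟩, h1.1⟩
  intro s hs t ht hst
  rcases hst.lt_or_gt with h | h
  · exact key s hs t ht h
  · exact (key t ht s hs h).symm

lemma measurableSet_firstEntry {m : MeasurableSpace Ω} (𝓕 : Filtration ι m) {D : Finset ι}
    {B : ι → Set Ω} (hB : ∀ t, MeasurableSet[𝓕 t] (B t)) (t : ι) :
    MeasurableSet[𝓕 t] (firstEntry D B t) := by
  refine (hB t).diff (Finset.measurableSet_biUnion _ fun s hs => ?_)
  exact 𝓕.mono (Finset.mem_filter.1 hs).2.le _ (hB s)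

lemma measure_iUnion_le_of_finset {m : MeasurableSpace Ω} {μ : Measure Ω} {S : ι → Set Ω}
    {c : ℝ≥0∞} (h : ∀ D : Finset ι, μ (⋃ t ∈ D, S t) ≤ c) (d : ℕ → ι) :
    μ (⋃ k, S (d k)) ≤ c := by
  classical
  rw [measure_iUnion_eq_iSup_accumulate]
  refine iSup_le fun n => le_trans (measure_mono ?_) (h ((Finset.range (n + 1)).image d))
  intro ω hω
  obtain ⟨k, hk, hω⟩ := Set.mem_accumulate.1 hω
  simp only [Set.mem_iUnion]
  exact ⟨d k, Finset.mem_image_of_mem d (Finset.mem_range.2 (by omega)), hω⟩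

/-- The maximal inequality for the martingale closed by a nonnegative variable `W`. -/
lemma maximal_ineq_condExp {m : MeasurableSpace Ω} (μ : Measure Ω) [IsProbabilityMeasure μ]
    (𝓕 : Filtration ι m) {W : Ω → ℝ} (hW : Integrable W μ) (hW0 : 0 ≤ W) {c : ℝ} (hc : 0 < c)
    (d : ℕ → ι) :
    μ (⋃ k, {ω | c ≤ (μ[W | 𝓕 (d k)]) ω}) ≤ ENNReal.ofReal ((∫ ω, W ω ∂μ) / c) := by
  refine measure_iUnion_le_of_finset (S := fun t => {ω | c ≤ (μ[W | 𝓕 t]) ω}) (fun D => ?_) d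
  set B : ι → Set Ω := fun t => {ω | c ≤ (μ[W | 𝓕 t]) ω}
  have hB : ∀ t, MeasurableSet[𝓕 t] (B t) := fun t =>
    stronglyMeasurable_condExp.measurable measurableSet_Ici
  have hC := measurableSet_firstEntry 𝓕 (D := D) hB
  have hC' : ∀ t, MeasurableSet (firstEntry D B t) := fun t => 𝓕.le t _ (hC t)
  have hsub : (⋃ t ∈ D, B t) ⊆ ⋃ t ∈ D, firstEntry D B t := by
    intro ω hω
    simp only [Set.mem_iUnion] at hω ⊢
    obtain ⟨t, ht, hω⟩ := hω
    obtain ⟨s, hs, -, h⟩ := exists_mem_firstEntry ht hω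
    exact ⟨s, hs, h⟩
  refine (measure_mono hsub).trans ?_
  rw [← ofReal_measureReal (measure_ne_top μ _)]
  refine ENNReal.ofReal_le_ofReal ((le_div_iff₀' hc).2 ?_)
  rw [measureReal_biUnion_finset (pairwiseDisjoint_firstEntry D B) fun t _ => hC' t,
    Finset.mul_sum]
  calc ∑ t ∈ D, c * μ.real (firstEntry D B t)
      ≤ ∑ t ∈ D, ∫ ω in firstEntry D B t, W ω ∂μ := by
        refine Finset.sum_le_sum fun t _ => ?_
        -- The first-entry set at `t` belongs to `𝓕 t`, so `W` may be replaced by its conditional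
        -- expectation, which is at least `c` there.
        rw [← setIntegral_condExp (𝓕.le t) hW (hC t)]
        exact setIntegral_ge_of_const_le_real (hC' t) (by finiteness) (fun ω hω => hω.1)
          integrable_condExp.integrableOn
    _ = ∫ ω in ⋃ t ∈ D, firstEntry D B t, W ω ∂μ :=
        (integral_biUnion_finset D (fun t _ => hC' t) (pairwiseDisjoint_firstEntry D B)
          fun t _ => hW.integrableOn).symm
    _ ≤ ∫ ω, W ω ∂μ := setIntegral_le_integral hW (ae_of_all _ hW0)

end FirstEntry

/-! ### Lower bound for `A` before `τ`. -/

section Survival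

variable {Ω : Type*} {m : MeasurableSpace Ω} {τ : Ω → ℝ≥0∞}

lemma measurableSet_lt_randomTime (hτ : IsRandomTime τ) (t : ℝ≥0) :
    MeasurableSet {ω | (t : ℝ≥0∞) < τ ω} :=
  measurableSet_lt measurable_const hτ.measurable

lemma integrable_survival (μ : Measure Ω) [IsFiniteMeasure μ] (hτ : IsRandomTime τ) (t : ℝ≥0) :
    Integrable (survival τ t) μ :=
  (integrable_const 1).indicator (measurableSet_lt_randomTime hτ t)

/-- The probability that the projection of `1_{[0, τ)}` falls below `c` before `τ`, along a
countable set of times, is at most `c`. -/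
lemma measure_condExp_survival_lt_le (μ : Measure Ω) [IsProbabilityMeasure μ]
    (𝓕 : Filtration ℝ≥0 m) (hτ : IsRandomTime τ) {c : ℝ} (hc : 0 ≤ c) (d : ℕ → ℝ≥0) :
    μ (⋃ k, {ω | (μ[survival τ (d k) | 𝓕 (d k)]) ω < c} ∩ {ω | (d k : ℝ≥0∞) < τ ω})
      ≤ ENNReal.ofReal c := by
  refine measure_iUnion_le_of_finset
    (S := fun t => {ω | (μ[survival τ t | 𝓕 t]) ω < c} ∩ {ω | (t : ℝ≥0∞) < τ ω}) (fun D => ?_) d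
  set B : ℝ≥0 → Set Ω := fun t => {ω | (μ[survival τ t | 𝓕 t]) ω < c}
  set L : ℝ≥0 → Set Ω := fun t => {ω | (t : ℝ≥0∞) < τ ω}
  have hL : ∀ t, MeasurableSet (L t) := measurableSet_lt_randomTime hτ
  have hB : ∀ t, MeasurableSet[𝓕 t] (B t) := fun t =>
    (stronglyMeasurable_condExp (f := survival τ t) (m := 𝓕 t) (μ := μ)).measurable
      (measurableSet_Iio (a := c))
  have hC := measurableSet_firstEntry 𝓕 (D := D) hB
  have hC' : ∀ t, MeasurableSet (firstEntry D B t) := fun t => 𝓕.le t _ (hC t)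
  have hsub : (⋃ t ∈ D, B t ∩ L t) ⊆ ⋃ t ∈ D, firstEntry D B t ∩ L t := by
    intro ω hω
    simp only [Set.mem_iUnion] at hω ⊢
    obtain ⟨t, ht, hω, hl⟩ := hω
    obtain ⟨s, hs, hst, h⟩ := exists_mem_firstEntry ht hω
    exact ⟨s, hs, h, lt_of_le_of_lt (ENNReal.coe_le_coe.2 hst) hl⟩
  refine (measure_mono hsub).trans ?_
  rw [← ofReal_measureReal (measure_ne_top μ _)]
  refine ENNReal.ofReal_le_ofReal ?_
  rw [measureReal_biUnion_finset
    ((pairwiseDisjoint_firstEntry D B).mono fun t => Set.inter_subset_left)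
    fun t _ => (hC' t).inter (hL t)]
  calc ∑ t ∈ D, μ.real (firstEntry D B t ∩ L t)
      ≤ ∑ t ∈ D, c * μ.real (firstEntry D B t) := by
        refine Finset.sum_le_sum fun t _ => ?_
        have h1 : μ.real (firstEntry D B t ∩ L t)
            = ∫ ω in firstEntry D B t, survival τ t ω ∂μ := by
          rw [show survival τ t = (L t).indicator fun _ => 1 from rfl,
            setIntegral_indicator (hL t)]
          simp
        rw [h1, ← setIntegral_condExp (𝓕.le t) (integrable_survival μ hτ t) (hC t)]
        calc _ ≤ ∫ _ in firstEntry D B t, c ∂μ :=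
              setIntegral_mono_on integrable_condExp.integrableOn
                (integrable_const c).integrableOn (hC' t) fun ω hω => le_of_lt hω.1
          _ = _ := by simp [mul_comm]
    _ = c * μ.real (⋃ t ∈ D, firstEntry D B t) := by
        rw [measureReal_biUnion_finset (pairwiseDisjoint_firstEntry D B) fun t _ => hC' t,
          Finset.mul_sum]
    -- Disjointness keeps the total mass of the first-entry sets at most `1`, so the bound does not
    -- depend on `D`.
    _ ≤ c := mul_le_of_le_one_right hc measureReal_le_one

lemma azema_ae_eq_condExp {μ : Measure Ω} {𝓕 : Filtration ℝ≥0 m} {A : ℝ≥0 → Ω → ℝ}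
    (hA : IsAzemaSupermartingale μ 𝓕 τ A) (t : ℝ≥0) :
    A t =ᵐ[μ] μ[survival τ t | 𝓕 t] := by
  have h := hA.isOptionalProjection.projection _ (isStoppingTime_const 𝓕 t)
  have hv : ∀ X : ℝ≥0 → Ω → ℝ, valueAt X (fun _ => (t : WithTop ℝ≥0)) = X t := by
    intro X
    ext ω
    exact Set.indicator_of_mem (s := {ω : Ω | (t : WithTop ℝ≥0) < ⊤}) (WithTop.coe_lt_top t) _
  rwa [hv, hv, IsStoppingTime.measurableSpace_const] at h

/-- Only sample times in `(t, b)` are used, so a bound known only before `τ` extends from a dense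
sequence to every `t < τ`. -/
lemma mem_of_rightContinuous_of_dense {f : ℝ≥0 → ℝ} {t b : ℝ≥0} (htb : t < b)
    (hf : ContinuousWithinAt f (Set.Ici t) t) {d : ℕ → ℝ≥0} (hd : DenseRange d) {C : Set ℝ}
    (hC : IsClosed C) (h : ∀ k, t < d k → d k < b → f (d k) ∈ C) : f t ∈ C := by
  by_contra hn
  have hev : ∀ᶠ s in 𝓝[≥] t, f s ∈ Cᶜ := hf (hC.isOpen_compl.mem_nhds hn)
  obtain ⟨u, hu, hsub⟩ := (mem_nhdsGE_iff_exists_Ico_subset' htb).1 hev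
  obtain ⟨k, hk⟩ := hd.exists_mem_open (isOpen_Ioo (a := t) (b := min u b))
    (Set.nonempty_Ioo.2 (lt_min hu htb))
  exact hsub ⟨hk.1.le, hk.2.trans_le (min_le_left _ _)⟩
    (h k hk.1 (hk.2.trans_le (min_le_right _ _)))

/-- Almost surely, the Azéma supermartingale is bounded away from `0` on `[0, τ)`. -/
lemma ae_exists_pos_le_azema {μ : Measure Ω} [IsProbabilityMeasure μ] {𝓕 : Filtration ℝ≥0 m}
    (hτ : IsRandomTime τ) {A : ℝ≥0 → Ω → ℝ} (hA : IsAzemaSupermartingale μ 𝓕 τ A) :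
    ∀ᵐ ω ∂μ, ∃ c : ℝ, 0 < c ∧ ∀ t : ℝ≥0, (t : ℝ≥0∞) < τ ω → c ≤ A t ω := by
  obtain ⟨d, hd⟩ := TopologicalSpace.exists_dense_seq ℝ≥0
  let N : ℕ → Set Ω := fun n =>
    ⋃ k, {ω | (μ[survival τ (d k) | 𝓕 (d k)]) ω < 1 / ((n : ℝ) + 1)} ∩
      {ω | (d k : ℝ≥0∞) < τ ω}
  have hN : μ (⋂ n, N n) = 0 := by
    refine le_antisymm (ge_of_tendsto' (x := atTop) (?_ : Tendsto (fun n : ℕ =>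
      ENNReal.ofReal (1 / ((n : ℝ) + 1))) atTop (𝓝 0)) fun n => ?_) zero_le
    · simpa using ENNReal.tendsto_ofReal tendsto_one_div_add_atTop_nhds_zero_nat
    · exact (measure_mono (Set.iInter_subset _ n)).trans
        (measure_condExp_survival_lt_le μ 𝓕 hτ (by positivity) d)
  filter_upwards [measure_eq_zero_iff_ae_notMem.1 hN, hA.cadlag,
    ae_all_iff.2 fun k => azema_ae_eq_condExp hA (d k)] with ω h1 h2 h3
  simp only [Set.mem_iInter, not_forall] at h1
  obtain ⟨n, hn⟩ := h1
  refine ⟨1 / ((n : ℝ) + 1), by positivity, fun t ht => ?_⟩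
  obtain ⟨b, htb, hb⟩ := ENNReal.lt_iff_exists_nnreal_btwn.1 ht
  refine mem_of_rightContinuous_of_dense (C := Set.Ici _) (ENNReal.coe_lt_coe.1 htb) (h2 t).1 hd
    isClosed_Ici fun k _ hkb => ?_
  by_contra hlt
  refine hn (Set.mem_iUnion.2 ⟨k, ?_, (ENNReal.coe_lt_coe.2 hkb).trans hb⟩)
  simpa [← h3 k] using hlt

/-! ### Convergence of `A` at infinity. -/

lemma iSup_filtration_natCast (𝓕 : Filtration ℝ≥0 m) : ⨆ n : ℕ, 𝓕 n = ⨆ t, 𝓕 t := by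
  refine le_antisymm (iSup_le fun n => le_iSup (fun t => 𝓕 t) (n : ℝ≥0)) (iSup_le fun t => ?_)
  obtain ⟨n, hn⟩ := exists_nat_ge t
  exact (𝓕.mono hn).trans (le_iSup (fun n : ℕ => 𝓕 n) n)

/-- The indicator of `{τ = ∞}`. -/
noncomputable def eternal (τ : Ω → ℝ≥0∞) : Ω → ℝ :=
  {ω | τ ω = ∞}.indicator fun _ => 1

lemma integrable_eternal (μ : Measure Ω) [IsFiniteMeasure μ] (hτ : IsRandomTime τ) :
    Integrable (eternal τ) μ :=
  (integrable_const 1).indicator (hτ.measurable (measurableSet_singleton ∞))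

lemma eternal_le_survival (τ : Ω → ℝ≥0∞) (t : ℝ≥0) (ω : Ω) : eternal τ ω ≤ survival τ t ω := by
  by_cases h : τ ω = ∞
  · simp [eternal, survival, h]
  · simp only [eternal, Set.indicator, Set.mem_ofPred_eq, h, if_false, survival]
    split_ifs <;> norm_num

lemma survival_anti (τ : Ω → ℝ≥0∞) {s t : ℝ≥0} (hst : s ≤ t) (ω : Ω) :
    survival τ t ω ≤ survival τ s ω :=
  Set.indicator_le_indicator_of_subset
    (fun _ h => lt_of_le_of_lt (ENNReal.coe_le_coe.2 hst) h) (fun _ => zero_le_one) ω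

lemma tendsto_integral_survival_sub_eternal (μ : Measure Ω) [IsFiniteMeasure μ]
    (hτ : IsRandomTime τ) :
    Tendsto (fun n : ℕ => ∫ ω, (survival τ n ω - eternal τ ω) ∂μ) atTop (𝓝 0) := by
  rw [← integral_zero Ω ℝ (μ := μ)]
  refine tendsto_integral_of_dominated_convergence (fun _ => 1)
    (fun n => ((integrable_survival μ hτ n).sub (integrable_eternal μ hτ)).aestronglyMeasurable)
    (integrable_const 1) (fun n => ae_of_all _ fun ω => ?_) (ae_of_all _ fun ω => ?_)
  · rw [Real.norm_of_nonneg (sub_nonneg.2 (eternal_le_survival τ n ω))]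
    have h1 : survival τ n ω ≤ 1 := Set.indicator_le_self' (fun _ _ => zero_le_one) ω
    have h2 : 0 ≤ eternal τ ω := Set.indicator_nonneg (fun _ _ => zero_le_one) ω
    linarith
  · refine tendsto_const_nhds.congr' ?_
    by_cases h : τ ω = ∞
    · simp [eternal, survival, h]
    · obtain ⟨n, hn⟩ := exists_nat_ge (τ ω).toNNReal
      filter_upwards [eventually_ge_atTop n] with k hk
      have : τ ω ≤ ((k : ℝ≥0) : ℝ≥0∞) := by
        rw [← ENNReal.coe_toNNReal h]
        exact ENNReal.coe_le_coe.2 (hn.trans (by exact_mod_cast hk))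
      simp only [eternal, survival, Set.indicator, Set.mem_ofPred_eq, h, not_lt.2 this, if_false,
        sub_zero]

/-- The variable `1_{n < τ < ∞} + |A_∞ - P[τ = ∞ | 𝓕 n]|`. -/
noncomputable def tailBound (μ : Measure Ω) (𝓕 : Filtration ℝ≥0 m) (τ : Ω → ℝ≥0∞) (n : ℕ)
    (ω : Ω) : ℝ :=
  (survival τ n ω - eternal τ ω) + |terminal μ 𝓕 τ ω - (μ[eternal τ | 𝓕 n]) ω|

lemma tailBound_nonneg (μ : Measure Ω) (𝓕 : Filtration ℝ≥0 m) (τ : Ω → ℝ≥0∞) (n : ℕ) :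
    0 ≤ tailBound μ 𝓕 τ n := fun ω =>
  add_nonneg (sub_nonneg.2 (eternal_le_survival τ n ω)) (abs_nonneg _)

lemma integrable_terminal_sub (μ : Measure Ω) (𝓕 : Filtration ℝ≥0 m) (τ : Ω → ℝ≥0∞) (n : ℕ) :
    Integrable (fun ω => terminal μ 𝓕 τ ω - (μ[eternal τ | 𝓕 n]) ω) μ :=
  integrable_condExp.sub integrable_condExp

lemma integrable_tailBound (μ : Measure Ω) [IsFiniteMeasure μ] (𝓕 : Filtration ℝ≥0 m)
    (hτ : IsRandomTime τ) (n : ℕ) : Integrable (tailBound μ 𝓕 τ n) μ :=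
  ((integrable_survival μ hτ n).sub (integrable_eternal μ hτ)).add
    (integrable_terminal_sub μ 𝓕 τ n).abs

/-- The restriction of a filtration to integer times. -/
def natFiltration (𝓕 : Filtration ℝ≥0 m) : Filtration ℕ m where
  seq n := 𝓕 n
  mono' _ _ h := 𝓕.mono (Nat.cast_le.2 h)
  le' n := 𝓕.le n

lemma tendsto_ae_condExp_eternal (μ : Measure Ω) [IsFiniteMeasure μ] (𝓕 : Filtration ℝ≥0 m)
    (τ : Ω → ℝ≥0∞) :
    ∀ᵐ ω ∂μ, Tendsto (fun n : ℕ => (μ[eternal τ | 𝓕 n]) ω) atTop (𝓝 (terminal μ 𝓕 τ ω)) := by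
  have h := tendsto_ae_condExp (μ := μ) (ℱ := natFiltration 𝓕) (eternal τ)
  rw [show (⨆ n, natFiltration 𝓕 n) = ⨆ t, 𝓕 t from iSup_filtration_natCast 𝓕] at h
  exact h

lemma tendsto_integral_tailBound (μ : Measure Ω) [IsFiniteMeasure μ] (𝓕 : Filtration ℝ≥0 m)
    (hτ : IsRandomTime τ) :
    Tendsto (fun n => ∫ ω, tailBound μ 𝓕 τ n ω ∂μ) atTop (𝓝 0) := by
  -- The `L¹` form of Lévy's upward theorem.
  have h := tendsto_eLpNorm_condExp (μ := μ) (ℱ := natFiltration 𝓕) (eternal τ)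
  rw [show (⨆ n, natFiltration 𝓕 n) = ⨆ t, 𝓕 t from iSup_filtration_natCast 𝓕] at h
  have h2 : Tendsto (fun n : ℕ => ∫ ω, |terminal μ 𝓕 τ ω - (μ[eternal τ | 𝓕 n]) ω| ∂μ)
      atTop (𝓝 0) := by
    have h' := (ENNReal.tendsto_toReal ENNReal.zero_ne_top).comp h
    simp only [ENNReal.toReal_zero] at h'
    refine h'.congr fun n => ?_
    have h1 := integral_norm_eq_lintegral_enorm
      (integrable_terminal_sub μ 𝓕 τ n).aestronglyMeasurable
    simp only [Real.norm_eq_abs] at h1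
    rw [h1, ← eLpNorm_one_eq_lintegral_enorm, Function.comp, eLpNorm_sub_comm]
    rfl
  have h3 := (tendsto_integral_survival_sub_eternal μ hτ).add h2
  rw [add_zero] at h3
  refine h3.congr fun n => ?_
  exact (integral_add ((integrable_survival μ hτ n).sub (integrable_eternal μ hτ))
    (integrable_terminal_sub μ 𝓕 τ n).abs).symm

/-- The difference on the left is the `𝓕 t`-conditional expectation of the variable `Z` below, and
`|Z|` is at most the tail bound because survival decreases in time. -/
lemma abs_azema_sub_le {μ : Measure Ω} [IsProbabilityMeasure μ] {𝓕 : Filtration ℝ≥0 m}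
    (hτ : IsRandomTime τ) {A : ℝ≥0 → Ω → ℝ} (hA : IsAzemaSupermartingale μ 𝓕 τ A) {n : ℕ}
    {t : ℝ≥0} (hnt : n ≤ t) :
    ∀ᵐ ω ∂μ, |A t ω - (μ[eternal τ | 𝓕 n]) ω| ≤ (μ[tailBound μ 𝓕 τ n | 𝓕 t]) ω := by
  have hS := integrable_survival μ hτ t
  have hJ := integrable_eternal μ hτ
  have hT := integrable_terminal_sub μ 𝓕 τ n
  let Z : Ω → ℝ := (survival τ t - eternal τ) + (terminal μ 𝓕 τ - μ[eternal τ | 𝓕 n])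
  have hZ : Integrable Z μ := (hS.sub hJ).add hT
  have hle : (⨆ t, 𝓕 t) ≤ m := iSup_le 𝓕.le
  have e1 : μ[Z | 𝓕 t] =ᵐ[μ] μ[survival τ t - eternal τ | 𝓕 t]
      + μ[terminal μ 𝓕 τ - μ[eternal τ | 𝓕 n] | 𝓕 t] := condExp_add (hS.sub hJ) hT _
  have e2 := condExp_sub (μ := μ) hS hJ (𝓕 t)
  have e3 : μ[terminal μ 𝓕 τ - μ[eternal τ | 𝓕 n] | 𝓕 t] =ᵐ[μ]
      μ[terminal μ 𝓕 τ | 𝓕 t] - μ[μ[eternal τ | 𝓕 n] | 𝓕 t] :=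
    condExp_sub integrable_condExp integrable_condExp _
  have e4 : μ[terminal μ 𝓕 τ | 𝓕 t] =ᵐ[μ] μ[eternal τ | 𝓕 t] :=
    condExp_condExp_of_le (le_iSup (fun t => 𝓕 t) t) hle
  -- Since `n ≤ t`, this variable is already `𝓕 t`-measurable.
  have e5 : μ[μ[eternal τ | 𝓕 n] | 𝓕 t] = μ[eternal τ | 𝓕 n] :=
    condExp_of_stronglyMeasurable (𝓕.le t) (stronglyMeasurable_condExp.mono (𝓕.mono hnt))
      integrable_condExp
  have hmono : μ[fun ω => ‖Z ω‖ | 𝓕 t] ≤ᵐ[μ] μ[tailBound μ 𝓕 τ n | 𝓕 t] := by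
    refine condExp_mono hZ.norm (integrable_tailBound μ 𝓕 hτ n) (ae_of_all _ fun ω => ?_)
    refine (norm_add_le _ _).trans (add_le_add ?_ le_rfl)
    rw [Pi.sub_apply, Real.norm_of_nonneg (sub_nonneg.2 (eternal_le_survival τ t ω))]
    exact sub_le_sub_right (survival_anti τ hnt ω) _
  filter_upwards [azema_ae_eq_condExp hA t, e1, e2, e3, e4, norm_condExp_le (μ := μ)
    (m := 𝓕 t) Z, hmono] with ω h0 h1 h2 h3 h4 h5 h6
  refine le_trans (le_of_eq ?_) (h5.trans h6)
  rw [Real.norm_eq_abs, h1, Pi.add_apply, h2, h3, Pi.sub_apply, Pi.sub_apply, h4, e5, h0]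
  congr 1
  ring

/-- Each tail intersection is null. Escaping infinitely many `B k` replaces a Borel–Cantelli
argument, so no summability is needed. -/
lemma ae_exists_notMem_of_tendsto_measure {μ : Measure Ω} {B : ℕ → Set Ω}
    (hB : Tendsto (fun n => μ (B n)) atTop (𝓝 0)) :
    ∀ᵐ ω ∂μ, ∀ n, ∃ k, n ≤ k ∧ ω ∉ B k := by
  refine ae_all_iff.2 fun n => ?_
  have h : μ (⋂ k ∈ Set.Ici n, B k) = 0 := by
    refine le_antisymm (ge_of_tendsto hB ?_) zero_le
    filter_upwards [eventually_ge_atTop n] with k hk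
    exact measure_mono (Set.biInter_subset_of_mem hk)
  filter_upwards [measure_eq_zero_iff_ae_notMem.1 h] with ω hω
  simpa using hω

/-- The Azéma supermartingale converges to its terminal variable. -/
lemma tendsto_azema_terminal {μ : Measure Ω} [IsProbabilityMeasure μ] {𝓕 : Filtration ℝ≥0 m}
    (hτ : IsRandomTime τ) {A : ℝ≥0 → Ω → ℝ} (hA : IsAzemaSupermartingale μ 𝓕 τ A) :
    ∀ᵐ ω ∂μ, Tendsto (fun t : ℝ≥0 => A t ω) atTop (𝓝 (terminal μ 𝓕 τ ω)) := by
  obtain ⟨d, hd⟩ := TopologicalSpace.exists_dense_seq ℝ≥0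
  let B : ℕ → ℕ → Set Ω := fun j n =>
    ⋃ k, {ω | 1 / ((j : ℝ) + 1) ≤ (μ[tailBound μ 𝓕 τ n | 𝓕 (d k)]) ω}
  have hB : ∀ j, Tendsto (fun n => μ (B j n)) atTop (𝓝 0) := by
    intro j
    have hlim := ENNReal.tendsto_ofReal
      ((tendsto_integral_tailBound μ 𝓕 hτ).div_const (1 / ((j : ℝ) + 1)))
    rw [zero_div, ENNReal.ofReal_zero] at hlim
    exact tendsto_of_tendsto_of_tendsto_of_le_of_le tendsto_const_nhds hlim
      (fun _ => zero_le) fun n => maximal_ineq_condExp μ 𝓕 (integrable_tailBound μ 𝓕 hτ n)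
        (tailBound_nonneg μ 𝓕 τ n) (by positivity) d
  have hdom : ∀ᵐ ω ∂μ, ∀ n k : ℕ, (n : ℝ≥0) ≤ d k →
      |A (d k) ω - (μ[eternal τ | 𝓕 n]) ω| ≤ (μ[tailBound μ 𝓕 τ n | 𝓕 (d k)]) ω := by
    refine ae_all_iff.2 fun n => ae_all_iff.2 fun k => ?_
    by_cases hnk : (n : ℝ≥0) ≤ d k
    · filter_upwards [abs_azema_sub_le hτ hA hnk] with ω hω _ using hω
    · exact ae_of_all _ fun ω h => absurd h hnk
  filter_upwards [ae_all_iff.2 fun j => ae_exists_notMem_of_tendsto_measure (hB j), hdom,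
    hA.cadlag, tendsto_ae_condExp_eternal μ 𝓕 τ] with ω h1 h2 h3 h4
  rw [Metric.tendsto_atTop]
  intro ε hε
  obtain ⟨j, hj⟩ := exists_nat_one_div_lt (half_pos hε)
  obtain ⟨n₀, hn₀⟩ := Metric.tendsto_atTop.1 h4 (ε / 2) (half_pos hε)
  -- One good `n ≥ n₀` suffices: the maximal inequality then controls all `t ≥ n` at once.
  obtain ⟨n, hn, hωn⟩ := h1 j n₀
  refine ⟨n, fun t ht => ?_⟩
  have hcl : A t ω ∈ Metric.closedBall ((μ[eternal τ | 𝓕 n]) ω) (1 / ((j : ℝ) + 1)) := by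
    -- The upper end `t + 1` is arbitrary, as the estimate holds at all sample times after `n`.
    refine mem_of_rightContinuous_of_dense (lt_add_one t) (h3 t).1 hd Metric.isClosed_closedBall
      fun k hk _ => ?_
    have hlt : (μ[tailBound μ 𝓕 τ n | 𝓕 (d k)]) ω < 1 / ((j : ℝ) + 1) := by
      by_contra hcon
      exact hωn (Set.mem_iUnion.2 ⟨k, not_lt.1 hcon⟩)
    exact (h2 n k (ht.trans hk.le)).trans hlt.le
  calc dist (A t ω) (terminal μ 𝓕 τ ω)
      ≤ dist (A t ω) ((μ[eternal τ | 𝓕 n]) ω)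
        + dist ((μ[eternal τ | 𝓕 n]) ω) (terminal μ 𝓕 τ ω) := dist_triangle _ _ _
    _ < ε / 2 + ε / 2 := add_lt_add (lt_of_le_of_lt hcl hj) (hn₀ n hn)
    _ = ε := add_halves ε

lemma le_leftLim_of_isCadlag {f : ℝ≥0 → ℝ} (hf : IsCadlag f) {c : ℝ} {t : ℝ≥0}
    (ht : 0 < t) (h : ∀ s < t, c ≤ f s) : c ≤ Function.leftLim f t := by
  obtain ⟨l, hl⟩ := (hf t).2
  have : (𝓝[<] t).NeBot := nhdsLT_neBot_of_exists_lt ⟨0, ht⟩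
  rw [leftLim_eq_of_tendsto hl]
  exact ge_of_tendsto hl (eventually_mem_nhdsWithin.mono h)

end Survival

end Azema

/-- Strict positivity of the Azéma supermartingale `A` on `[0, τ)` and of `A_-` on `[0, τ]`.
The interval `[0, τ]` contains the point `∞` when `τ = ∞`; there `A_{∞-} = A_∞`, and the last
part says that this is indeed the limit of `A_t` as `t → ∞`. -/
theorem mainTheorem10 {Ω : Type*} {m : MeasurableSpace Ω} (μ : Measure Ω)
    [IsProbabilityMeasure μ] [μ.IsComplete] (𝓕 : Filtration ℝ≥0 m)
    (h𝓕 : Azema.UsualConditions μ 𝓕) (τ : Ω → ℝ≥0∞) (hτ : Azema.IsRandomTime τ)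
    (A : ℝ≥0 → Ω → ℝ) (hA : Azema.IsAzemaSupermartingale μ 𝓕 τ A) :
    (∀ᵐ ω ∂μ, ∀ t : ℝ≥0, (t : ℝ≥0∞) < τ ω → 0 < A t ω) ∧
    (∀ᵐ ω ∂μ, ∀ t : ℝ≥0∞, t ≤ τ ω →
      0 < Azema.leftLimit A (Azema.terminal μ 𝓕 τ) t ω) ∧
    (∀ᵐ ω ∂μ, Tendsto (fun t : ℝ≥0 => A t ω) atTop (𝓝 (Azema.terminal μ 𝓕 τ ω))) := by
  have hpos := Azema.ae_exists_pos_le_azema hτ hA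
  have hlim := Azema.tendsto_azema_terminal hτ hA
  refine ⟨?_, ?_, hlim⟩
  · filter_upwards [hpos] with ω ⟨c, hc, h⟩ t ht using hc.trans_le (h t ht)
  · filter_upwards [hpos, hlim, hA.cadlag] with ω ⟨c, hc, h⟩ hω hcad t ht
    refine hc.trans_le ?_
    by_cases htop : t = ∞
    · have hτω : τ ω = ∞ := top_le_iff.1 (htop ▸ ht)
      rw [Azema.leftLimit, if_pos htop]
      exact ge_of_tendsto' hω fun s => h s (hτω ▸ ENNReal.coe_lt_top)
    · lift t to ℝ≥0 using htop
      rw [Azema.leftLimit, if_neg ENNReal.coe_ne_top, ENNReal.toNNReal_coe]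
      rcases eq_or_ne t 0 with rfl | h0
      -- At `0` the left limit is by convention `A_0`, and `0 < τ` makes the bound available there.
      · rw [leftLim_eq_of_isBot fun s => zero_le]
        exact h 0 (hτ.pos ω)
      · exact Azema.le_leftLim_of_isCadlag hcad (pos_iff_ne_zero.2 h0) fun s hs =>
          h s ((ENNReal.coe_lt_coe.2 hs).trans_le ht)
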